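/- **Setting.** Let $Y,U$ be real Hilbert spaces with duals $Y^*,U^*$, let $Q\subset\mathbb R^n$ be a nonempty bounded polyhedron with nonempty interior, let $U_{ad}\subset U$ be nonempty, closed and convex, let $A\in L[Y,Y^*]$ be an isomorphism, $B\in L[U,Y^*]$ and $S:=A^{-1}B$. Let $F,f:Q\times Y\times U\to\mathbb R$ be convex, bounded from below and continuously Fréchet differentiable (derivatives at boundary points of $Q$ being taken relative to $Q\times Y\times U$). Assume that for every $M\ge0$ there is $L_M\ge 0$ such that $$\|f'_\beta(\beta_1,y_1,u_1)-f'_\beta(\beta_2,y_2,u_2)\|\le L_M\big(\|\beta_1-\beta_2\|+\|y_1-y_2\|_Y+\|u_1-u_2\|_U\big),$$ $$|F(\beta,y_1,u_1)-F(\beta,y_2,u_2)|\le L_M\big(\|y_1-y_2\|_Y+\|u_1-u_2\|_U\big),$$ $$\|f'_u(\beta_1,Su,u)-f'_u(\beta_2,Su,u)\|_{U^*}\le L_M\|\beta_1-\beta_2\|,\qquad \|f'_y(\beta_1,Su,u)-f'_y(\beta_2,Su,u)\|_{Y^*}\le L_M\|\beta_1-\beta_2\|$$ for all $\beta,\beta_1,\beta_2\in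 Q$, all $y_1,y_2\in Y$ with norm at most $M$ and all $u,u_1,u_2\in U_{ad}$ with norm at most $M$. Assume also that there is $\mu>0$ with $$f(\beta,Su_2,u_2)\ge f(\beta,Su_1,u_1)+\langle f'_y(\beta,Su_1,u_1),S(u_2-u_1)\rangle+\langle f'_u(\beta,Su_1,u_1),u_2-u_1\rangle+\tfrac\mu2\|u_2-u_1\|_U^2$$ for all $\beta\in Q$, $u_1,u_2\in U_{ad}$. Let $\varphi(\beta):=\inf\{f(\beta,y,u): Ay-Bu=0,\ u\in U_{ad}\}$ be the optimal-value function, and consider the problem $$\text{(OVR)}\qquad \min_{\beta,y,u}F(\beta,y,u)\quad\text{s.t.}\quad \beta\in Q,\ f(\beta,y,u)\le\varphi(\beta),\ Ay-Bu=0,\ u\in U_{ad}.$$ **Algorithm.** A *subdivision* of a set $X\subset\mathbb R^n$ is a finite family of nondegenerate $n$-simplices with union $X$ (overlaps and hanging nodes are allowed). For a simplex $T$, let $\xi_T$ be the affine interpolant of $\varphi$ in the vertices of $T$, $\mathrm{vol}(T)$ its Lebesgue measure, and $\rho(T):=\mathrm{diam}(B_T)/\mathrm{diam}(T)$, where $B_T$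 is a largest ball contained in $T$. Let $P:\mathbb R\to\mathbb R$ be a penalty function. 1. Choose a subdivision $\mathcal T_1$ of $Q$ and parameters $q,\rho\in(0,1)$; set $k:=1$. 2. For every $T\in\mathcal T_k$ choose $\gamma_{k,T}>0$ and compute a global solution $(\beta_{k,T},y_{k,T},u_{k,T})$ of $$\min_{\beta,y,u} F(\beta,y,u)+\gamma_{k,T}P\big(f(\beta,y,u)-\xi_T(\beta)\big)\quad\text{s.t.}\quad\beta\in T,\ Ay-Bu=0,\ u\in U_{ad}.$$ Select $\bar T_k\in\mathcal T_k$ for which the optimal value of this problem is smallest among all $T\in\mathcal T_k$, and set $(\beta_k,y_k,u_k):=(\beta_{k,\bar T_k},y_{k,\bar T_k},u_{k,\bar T_k})$. 3. If $f(\beta_k,y_k,u_k)=\varphi(\beta_k)$, terminate. Otherwise construct $\mathcal T_{k+1}$ from $\mathcal T_k$ by a refinement of $\bar T_k$, i.e. by replacing $\bar T_k$ by the members of a subdivision of $\bar T_k$ that does not contain $\bar T_k$, such that $\mathrm{vol}(T)\le q\,\mathrm{vol}(\bar T_k)$ and $\rho(T)\ge\rho$ for all $T\in\mathcal T_{k+1}\setminus\mathcal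 T_k$. Set $k:=k+1$ and go to step 2. **Theorem.** Let $P$ be non-decreasing and convex with $P(s)=0$ for all $s\le0$ and $P(s)>0$ for all $s>0$. Consider any execution of the algorithm, which either terminates in step 3 or performs infinitely many iterations; in the latter case assume that $\gamma_{k,\bar T_k}\to\infty$ as $k\to\infty$. Then either the algorithm stops, and its last iterate $(\beta_k,y_k,u_k)$ is a global solution of (OVR), or it does not stop, and the computed sequence $(\beta_k,y_k,u_k)$ contains a subsequence converging strongly in $\mathbb R^n\times Y\times U$ to a global solution of (OVR). If the algorithm does not stop and (OVR) has a unique global solution $(\bar\beta,\bar y,\bar u)$, then the entire sequence $(\beta_k,y_k,u_k)$ converges strongly to $(\bar\beta,\bar y,\bar u)$. -/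

import Mathlib

open Set Filter Topology MeasureTheory

noncomputable section

/-- The data of the bilevel problem: parameter set `Q ⊆ ℝⁿ`, admissible controls `Uad ⊆ U`,
state operator `A : Y → Y*` (an isomorphism), control operator `B : U → Y*`, upper-level
objective `F` and lower-level objective `f`. Only the values of `F` and `f` on `Q × Y × U`
are ever used. -/
structure BilevelData (n : ℕ) (Y U : Type*)
    [NormedAddCommGroup Y] [InnerProductSpace ℝ Y]
    [NormedAddCommGroup U] [InnerProductSpace ℝ U] where
  Q : Set (EuclideanSpace ℝ (Fin n))
  Uad : Set U
  A : Y ≃L[ℝ] StrongDual ℝ Y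
  B : U →L[ℝ] StrongDual ℝ Y
  F : EuclideanSpace ℝ (Fin n) × Y × U → ℝ
  f : EuclideanSpace ℝ (Fin n) × Y × U → ℝ

/-- A polyhedron: an intersection of finitely many closed halfspaces. -/
def IsPolyhedron {n : ℕ} (Q : Set (EuclideanSpace ℝ (Fin n))) : Prop :=
  ∃ (m : ℕ) (a : Fin m → EuclideanSpace ℝ (Fin n)) (b : Fin m → ℝ),
    (∀ i, a i ≠ 0) ∧ Q = {x | ∀ i, inner ℝ (a i) x ≤ b i}

namespace BilevelData

variable {n : ℕ} {Y U : Type*}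
  [NormedAddCommGroup Y] [InnerProductSpace ℝ Y]
  [NormedAddCommGroup U] [InnerProductSpace ℝ U]

/-- The domain `Q × Y × U` of the objectives. -/
def domain (D : BilevelData n Y U) : Set (EuclideanSpace ℝ (Fin n) × Y × U) :=
  D.Q ×ˢ (univ : Set (Y × U))

/-- The control-to-state map `S = A⁻¹ B`. -/
def S (D : BilevelData n Y U) : U →L[ℝ] Y :=
  (D.A.symm : StrongDual ℝ Y →L[ℝ] Y).comp D.B

/-- The partial derivative of `f` with respect to `β ∈ Q` (relative to `Q`, so that it also makes
sense at boundary points of `Q`). -/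
def fβ (D : BilevelData n Y U) (β : EuclideanSpace ℝ (Fin n)) (y : Y) (u : U) :
    StrongDual ℝ (EuclideanSpace ℝ (Fin n)) :=
  fderivWithin ℝ (fun b => D.f (b, y, u)) D.Q β

/-- The partial derivative of `f` with respect to `y`. -/
def fy (D : BilevelData n Y U) (β : EuclideanSpace ℝ (Fin n)) (y : Y) (u : U) :
    StrongDual ℝ Y :=
  fderiv ℝ (fun z => D.f (β, z, u)) y

/-- The partial derivative of `f` with respect to `u`. -/
def fu (D : BilevelData n Y U) (β : EuclideanSpace ℝ (Fin n)) (y : Y) (u : U) :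
    StrongDual ℝ U :=
  fderiv ℝ (fun w => D.f (β, y, w)) u

/-- The standing assumptions on the bilevel problem. -/
structure StandingAssumption (D : BilevelData n Y U) : Prop where
  Q_polyhedron : IsPolyhedron D.Q
  Q_bounded : Bornology.IsBounded D.Q
  Q_interior : (interior D.Q).Nonempty
  Uad_nonempty : D.Uad.Nonempty
  Uad_closed : IsClosed D.Uad
  Uad_convex : Convex ℝ D.Uad
  F_bddBelow : BddBelow (D.F '' D.domain)
  f_bddBelow : BddBelow (D.f '' D.domain)
  F_convex : ConvexOn ℝ D.domain D.F
  f_convex : ConvexOn ℝ D.domain D.f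
  F_contDiff : ContDiffOn ℝ 1 D.F D.domain
  f_contDiff : ContDiffOn ℝ 1 D.f D.domain
  lipschitz : ∀ M : ℝ, 0 ≤ M → ∃ L : ℝ, 0 ≤ L ∧
    (∀ β₁ ∈ D.Q, ∀ β₂ ∈ D.Q, ∀ y₁ y₂ : Y, ‖y₁‖ ≤ M → ‖y₂‖ ≤ M →
      ∀ u₁ ∈ D.Uad, ∀ u₂ ∈ D.Uad, ‖u₁‖ ≤ M → ‖u₂‖ ≤ M →
        ‖D.fβ β₁ y₁ u₁ - D.fβ β₂ y₂ u₂‖ ≤ L * (‖β₁ - β₂‖ + ‖y₁ - y₂‖ + ‖u₁ - u₂‖)) ∧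
    (∀ β ∈ D.Q, ∀ y₁ y₂ : Y, ‖y₁‖ ≤ M → ‖y₂‖ ≤ M →
      ∀ u₁ ∈ D.Uad, ∀ u₂ ∈ D.Uad, ‖u₁‖ ≤ M → ‖u₂‖ ≤ M →
        |D.F (β, y₁, u₁) - D.F (β, y₂, u₂)| ≤ L * (‖y₁ - y₂‖ + ‖u₁ - u₂‖)) ∧
    (∀ β₁ ∈ D.Q, ∀ β₂ ∈ D.Q, ∀ u ∈ D.Uad, ‖u‖ ≤ M →
        ‖D.fu β₁ (D.S u) u - D.fu β₂ (D.S u) u‖ ≤ L * ‖β₁ - β₂‖) ∧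
    (∀ β₁ ∈ D.Q, ∀ β₂ ∈ D.Q, ∀ u ∈ D.Uad, ‖u‖ ≤ M →
        ‖D.fy β₁ (D.S u) u - D.fy β₂ (D.S u) u‖ ≤ L * ‖β₁ - β₂‖)
  strong_convex : ∃ μ : ℝ, 0 < μ ∧ ∀ β ∈ D.Q, ∀ u₁ ∈ D.Uad, ∀ u₂ ∈ D.Uad,
    D.f (β, D.S u₁, u₁) + D.fy β (D.S u₁) u₁ (D.S (u₂ - u₁)) + D.fu β (D.S u₁) u₁ (u₂ - u₁)
        + μ / 2 * ‖u₂ - u₁‖ ^ 2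
      ≤ D.f (β, D.S u₂, u₂)

/-- The optimal-value function of the lower-level problem,
`φ(β) = inf {f(β,y,u) : A y - B u = 0, u ∈ Uad}`. -/
def φ (D : BilevelData n Y U) (β : EuclideanSpace ℝ (Fin n)) : ℝ :=
  sInf {r | ∃ (y : Y) (u : U), D.A y - D.B u = 0 ∧ u ∈ D.Uad ∧ r = D.f (β, y, u)}

/-- The feasible set of the optimal-value reformulation (OVR). -/
def ovrFeasible (D : BilevelData n Y U) : Set (EuclideanSpace ℝ (Fin n) × Y × U) :=
  {x | x.1 ∈ D.Q ∧ D.f x ≤ D.φ x.1 ∧ D.A x.2.1 - D.B x.2.2 = 0 ∧ x.2.2 ∈ D.Uad}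

/-- `x = (β, y, u)` is a global solution of (OVR). -/
def IsOVRSolution (D : BilevelData n Y U) (x : EuclideanSpace ℝ (Fin n) × Y × U) : Prop :=
  x ∈ D.ovrFeasible ∧ ∀ z ∈ D.ovrFeasible, D.F x ≤ D.F z

end BilevelData

/-- Nondegenerate `n`-simplices in `ℝⁿ`, given by their `n + 1` vertices. -/
abbrev FullSimplex (n : ℕ) := Affine.Simplex ℝ (EuclideanSpace ℝ (Fin n)) n

namespace FullSimplex

variable {n : ℕ}

/-- The simplex as a subset of `ℝⁿ`. -/
def carrier (T : FullSimplex n) : Set (EuclideanSpace ℝ (Fin n)) :=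
  convexHull ℝ (range T.points)

/-- The vertices of a nondegenerate `n`-simplex form an affine basis of `ℝⁿ`. -/
def affineBasis (T : FullSimplex n) : AffineBasis (Fin (n + 1)) ℝ (EuclideanSpace ℝ (Fin n)) where
  toFun := T.points
  ind' := T.independent
  tot' := by
    rw [T.independent.affineSpan_eq_top_iff_card_eq_finrank_add_one]
    simp

/-- The affine interpolant of `g` in the vertices of `T` (in barycentric coordinates). -/
def interpolant (T : FullSimplex n) (g : EuclideanSpace ℝ (Fin n) → ℝ)
    (x : EuclideanSpace ℝ (Fin n)) : ℝ :=
  ∑ i, T.affineBasis.coord i x * g (T.points i)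

/-- The Lebesgue measure of the simplex. -/
def vol (T : FullSimplex n) : ℝ := volume.real T.carrier

/-- The aspect ratio `diam(B_T) / diam(T)`, where `B_T` is the largest ball contained in `T`. -/
def aspectRatio (T : FullSimplex n) : ℝ :=
  sSup {d | ∃ (c : EuclideanSpace ℝ (Fin n)) (r : ℝ), Metric.closedBall c r ⊆ T.carrier ∧
      d = Metric.diam (Metric.closedBall c r)} / Metric.diam T.carrier

end FullSimplex

/-- `𝒯` is a subdivision of the set `X`: a finite family of simplices whose union is `X`. The
simplices may overlap and hanging nodes are allowed. -/
def IsSubdivision {n : ℕ} (𝒯 : Set (FullSimplex n)) (X : Set (EuclideanSpace ℝ (Fin n))) : Prop :=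
  𝒯.Finite ∧ ⋃ T ∈ 𝒯, FullSimplex.carrier T = X

/-- `𝒯'` arises from `𝒯` by a refinement of `T`: the simplex `T` is replaced by the members of a
subdivision of `T` (which does not contain `T` itself). -/
def IsRefinementOf {n : ℕ} (𝒯' 𝒯 : Set (FullSimplex n)) (T : FullSimplex n) : Prop :=
  ∃ R : Set (FullSimplex n), IsSubdivision R T.carrier ∧ T ∉ R ∧ 𝒯' = (𝒯 \ {T}) ∪ R

namespace BilevelData

variable {n : ℕ} {Y U : Type*}
  [NormedAddCommGroup Y] [InnerProductSpace ℝ Y]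
  [NormedAddCommGroup U] [InnerProductSpace ℝ U]

/-- The affine interpolant `ξ_T` of the optimal-value function in the vertices of `T`. -/
def ξ (D : BilevelData n Y U) (T : FullSimplex n) (β : EuclideanSpace ℝ (Fin n)) : ℝ :=
  T.interpolant D.φ β

/-- The objective `F(β,y,u) + γ P(f(β,y,u) - ξ_T(β))` of the penalty problem (OVRP(T, γ)). -/
def penaltyObjective (D : BilevelData n Y U) (P : ℝ → ℝ) (T : FullSimplex n) (γ : ℝ)
    (x : EuclideanSpace ℝ (Fin n) × Y × U) : ℝ :=
  D.F x + γ * P (D.f x - D.ξ T x.1)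

/-- The feasible set of the penalty problem (OVRP(T, γ)). -/
def penaltyFeasible (D : BilevelData n Y U) (T : FullSimplex n) :
    Set (EuclideanSpace ℝ (Fin n) × Y × U) :=
  {x | x.1 ∈ T.carrier ∧ D.A x.2.1 - D.B x.2.2 = 0 ∧ x.2.2 ∈ D.Uad}

/-- `x = (β, y, u)` is a global solution of the penalty problem (OVRP(T, γ)). -/
def IsPenaltySolution (D : BilevelData n Y U) (P : ℝ → ℝ) (T : FullSimplex n) (γ : ℝ)
    (x : EuclideanSpace ℝ (Fin n) × Y × U) : Prop :=
  x ∈ D.penaltyFeasible T ∧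
    ∀ z ∈ D.penaltyFeasible T, D.penaltyObjective P T γ x ≤ D.penaltyObjective P T γ z

/-- The quantities produced by the penalty algorithm. Iterations are numbered from `0`. -/
structure PenaltyIterates (n : ℕ) (Y U : Type*) where
  /-- the subdivision of iteration `k` -/
  𝒯 : ℕ → Set (FullSimplex n)
  /-- the penalty parameter used in iteration `k` on a simplex -/
  γ : ℕ → FullSimplex n → ℝ
  /-- the solution of the penalty problem computed in iteration `k` on a simplex -/
  sol : ℕ → FullSimplex n → EuclideanSpace ℝ (Fin n) × Y × U
  /-- the simplex selected in iteration `k` -/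
  Tbar : ℕ → FullSimplex n

/-- The iterate `(β_k, y_k, u_k)`, i.e. the solution computed on the selected simplex. -/
def PenaltyIterates.x {n : ℕ} {Y U : Type*} (I : PenaltyIterates n Y U) (k : ℕ) :
    EuclideanSpace ℝ (Fin n) × Y × U :=
  I.sol k (I.Tbar k)

/-- `I` records a complete execution of the penalty algorithm with penalty function `P` and
parameters `q`, `ρ`, which performs exactly `N ∈ {1, 2, …, ∞}` iterations, namely the iterations
`k` with `k < N`. The entries of `I` with index `k ≥ N` are meaningless and unconstrained. -/
structure IsPenaltyRun (D : BilevelData n Y U) (P : ℝ → ℝ) (q ρ : ℝ)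
    (I : PenaltyIterates n Y U) (N : ℕ∞) : Prop where
  N_pos : 0 < N
  initial : IsSubdivision (I.𝒯 0) D.Q
  γ_pos : ∀ k : ℕ, (k : ℕ∞) < N → ∀ T ∈ I.𝒯 k, 0 < I.γ k T
  solves : ∀ k : ℕ, (k : ℕ∞) < N → ∀ T ∈ I.𝒯 k, D.IsPenaltySolution P T (I.γ k T) (I.sol k T)
  Tbar_mem : ∀ k : ℕ, (k : ℕ∞) < N → I.Tbar k ∈ I.𝒯 k
  Tbar_argmin : ∀ k : ℕ, (k : ℕ∞) < N → ∀ T ∈ I.𝒯 k,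
    D.penaltyObjective P (I.Tbar k) (I.γ k (I.Tbar k)) (I.sol k (I.Tbar k))
      ≤ D.penaltyObjective P T (I.γ k T) (I.sol k T)
  /-- the algorithm terminates in its last iteration by the stopping criterion … -/
  terminal : ∀ k : ℕ, N = (k : ℕ∞) + 1 → D.f (I.x k) = D.φ (I.x k).1
  /-- … which is not met in any earlier iteration -/
  not_terminal : ∀ k : ℕ, (k : ℕ∞) + 1 < N → D.f (I.x k) ≠ D.φ (I.x k).1
  refine_step : ∀ k : ℕ, (k : ℕ∞) + 1 < N → IsRefinementOf (I.𝒯 (k + 1)) (I.𝒯 k) (I.Tbar k)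
  refine_vol : ∀ k : ℕ, (k : ℕ∞) + 1 < N → ∀ T ∈ I.𝒯 (k + 1) \ I.𝒯 k,
    FullSimplex.vol T ≤ q * FullSimplex.vol (I.Tbar k)
  refine_aspect : ∀ k : ℕ, (k : ℕ∞) + 1 < N → ∀ T ∈ I.𝒯 (k + 1) \ I.𝒯 k,
    ρ ≤ FullSimplex.aspectRatio T

end BilevelData

end

/-! The penalty problems give lower bounds. Joint convexity of `f` makes `φ` convex, so the
interpolant satisfies `ξ_T ≥ φ` on every simplex `T ⊆ Q`. A point feasible for (OVR) therefore
carries no penalty on a simplex containing its parameter. As `Tbar k` has the smallest optimal value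
and the penalty is nonnegative, `F (x k) ≤ F z` for every feasible `z` (`penaltyObjective_le`,
`F_le`). A feasible iterate, or a feasible limit of iterates, is thus optimal.

Feasibility in the limit comes from three facts. The selected simplices shrink in volume, and the
bound on the aspect ratio turns this into vanishing diameter (`tendsto_diam`). Since `φ` is
Lipschitz, `ξ - φ` then vanishes along the iterates. Finally the penalty terms stay bounded while `γ
→ ∞`, so the positive part of `f - ξ` vanishes too. Together these give `f - φ → 0`
(`tendsto_f_sub_φ`).

Strong convergence needs no compactness in `U`: parameters subconverge in the compact set `Q`, and
strong convexity makes the asymptotically optimal controls a Cauchy sequence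
(`exists_tendsto_control`). The states follow by continuity of `S`. With a unique solution, the
subsequence principle gives convergence of the whole sequence. -/

lemma IsPolyhedron.isClosed {n : ℕ} {Q : Set (EuclideanSpace ℝ (Fin n))} (hQ : IsPolyhedron Q) :
    IsClosed Q := by
  obtain ⟨m, a, b, -, rfl⟩ := hQ
  simp only [ofPred_forall]
  exact isClosed_iInter fun i => isClosed_le (by fun_prop) continuous_const

lemma IsPolyhedron.convex {n : ℕ} {Q : Set (EuclideanSpace ℝ (Fin n))} (hQ : IsPolyhedron Q) :
    Convex ℝ Q := by
  obtain ⟨m, a, b, -, rfl⟩ := hQ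
  simp only [ofPred_forall]
  exact convex_iInter fun i => convex_halfSpace_le (innerₗ _ (a i)).isLinear (b i)

/-! ### The lower-level problem: regularity of the value function and stability of minimizers. -/

namespace BilevelData

section Lower

variable {n : ℕ} {Y U : Type*}
  [NormedAddCommGroup Y] [InnerProductSpace ℝ Y]
  [NormedAddCommGroup U] [InnerProductSpace ℝ U]
  {D : BilevelData n Y U}

lemma state_eq_iff (D : BilevelData n Y U) (y : Y) (u : U) :
    D.A y - D.B u = 0 ↔ y = D.S u := by
  rw [sub_eq_zero]
  constructor
  · intro h
    simp [S, ← h]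
  · rintro rfl
    simp [S]

lemma φ_eq (D : BilevelData n Y U) (β : EuclideanSpace ℝ (Fin n)) :
    D.φ β = sInf ((fun u => D.f (β, D.S u, u)) '' D.Uad) := by
  unfold φ
  congr 1
  ext r
  constructor
  · rintro ⟨y, u, h, hu, rfl⟩
    rw [state_eq_iff] at h
    exact ⟨u, hu, by rw [h]⟩
  · rintro ⟨u, hu, rfl⟩
    exact ⟨D.S u, u, (D.state_eq_iff _ _).2 rfl, hu, rfl⟩

namespace StandingAssumption

variable (hD : D.StandingAssumption)
include hD

lemma isCompact_Q : IsCompact D.Q :=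
  Metric.isCompact_of_isClosed_isBounded hD.Q_polyhedron.isClosed hD.Q_bounded

lemma convex_Q : Convex ℝ D.Q := hD.Q_polyhedron.convex

lemma exists_lower_bound : ∃ m : ℝ, ∀ β ∈ D.Q, ∀ y u, m ≤ D.f (β, y, u) := by
  obtain ⟨m, hm⟩ := hD.f_bddBelow
  exact ⟨m, fun β hβ y u => hm ⟨(β, y, u), ⟨hβ, mem_univ _⟩, rfl⟩⟩

lemma φ_le {β : EuclideanSpace ℝ (Fin n)} (hβ : β ∈ D.Q) {u : U} (hu : u ∈ D.Uad) :
    D.φ β ≤ D.f (β, D.S u, u) := by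
  rw [φ_eq]
  obtain ⟨m, hm⟩ := hD.exists_lower_bound
  exact csInf_le ⟨m, by rintro _ ⟨v, -, rfl⟩; exact hm β hβ _ _⟩ ⟨u, hu, rfl⟩

lemma exists_lt_φ_add (β : EuclideanSpace ℝ (Fin n)) {ε : ℝ} (hε : 0 < ε) :
    ∃ u ∈ D.Uad, D.f (β, D.S u, u) < D.φ β + ε := by
  have h : sInf ((fun u => D.f (β, D.S u, u)) '' D.Uad) < D.φ β + ε := by
    rw [← φ_eq]; linarith
  obtain ⟨_, ⟨u, hu, rfl⟩, h⟩ := exists_lt_of_csInf_lt (hD.Uad_nonempty.image _) h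
  exact ⟨u, hu, h⟩

/-- Strong convexity of the reduced lower-level objective, in midpoint form. -/
lemma exists_midpoint_ineq : ∃ μ : ℝ, 0 < μ ∧ ∀ β ∈ D.Q, ∀ u ∈ D.Uad, ∀ v ∈ D.Uad,
    ∃ w ∈ D.Uad, 2 * D.f (β, D.S w, w) + μ * ‖u - v‖ ^ 2
      ≤ D.f (β, D.S u, u) + D.f (β, D.S v, v) := by
  obtain ⟨μ, hμ, h⟩ := hD.strong_convex
  -- Strong convexity is used at the midpoint `w` towards `u` and towards `v`. The increments are
  -- opposite, so the derivative terms cancel in the sum, and `2 * (μ / 2) * (1 / 2) ^ 2 = μ / 4`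
  -- remains.
  refine ⟨μ / 4, by positivity, fun β hβ u hu v hv => ?_⟩
  have hw : (1 / 2 : ℝ) • u + (1 / 2 : ℝ) • v ∈ D.Uad :=
    hD.Uad_convex hu hv (by norm_num) (by norm_num) (by norm_num)
  set w := (1 / 2 : ℝ) • u + (1 / 2 : ℝ) • v with hwdef
  have e1 : u - w = (1 / 2 : ℝ) • (u - v) := by rw [hwdef]; module
  have e2 : v - w = -((1 / 2 : ℝ) • (u - v)) := by rw [hwdef]; module
  have h1 := h β hβ w hw u hu
  have h2 := h β hβ w hw v hv
  rw [e1] at h1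
  rw [e2] at h2
  simp only [map_neg, norm_neg] at h2
  have e3 : ‖(1 / 2 : ℝ) • (u - v)‖ = 1 / 2 * ‖u - v‖ := by
    rw [norm_smul]; norm_num
  rw [e3] at h1 h2
  exact ⟨w, hw, by nlinarith⟩

lemma exists_norm_sub_sq_le : ∃ μ : ℝ, 0 < μ ∧ ∀ β ∈ D.Q, ∀ u ∈ D.Uad, ∀ v ∈ D.Uad,
    μ * ‖u - v‖ ^ 2 ≤ (D.f (β, D.S u, u) - D.φ β) + (D.f (β, D.S v, v) - D.φ β) := by
  obtain ⟨μ, hμ, h⟩ := hD.exists_midpoint_ineq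
  refine ⟨μ, hμ, fun β hβ u hu v hv => ?_⟩
  obtain ⟨w, hw, h⟩ := h β hβ u hu v hv
  linarith [hD.φ_le hβ hw]

lemma exists_upper_bound (u : U) : ∃ K : ℝ, ∀ β ∈ D.Q, D.f (β, D.S u, u) ≤ K := by
  have hc : ContinuousOn (fun β => D.f (β, D.S u, u)) D.Q :=
    hD.f_contDiff.continuousOn.comp (by fun_prop) fun β hβ => ⟨hβ, mem_univ _⟩
  obtain ⟨K, hK⟩ := hD.isCompact_Q.bddAbove_image hc
  exact ⟨K, fun β hβ => hK ⟨β, hβ, rfl⟩⟩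

lemma exists_φ_le : ∃ K : ℝ, ∀ β ∈ D.Q, D.φ β ≤ K := by
  obtain ⟨u₀, hu₀⟩ := hD.Uad_nonempty
  obtain ⟨K, hK⟩ := hD.exists_upper_bound u₀
  exact ⟨K, fun β hβ => (hD.φ_le hβ hu₀).trans (hK β hβ)⟩

/-- Coercivity of the reduced lower-level objective, uniformly in the parameter. -/
lemma exists_norm_le (C : ℝ) : ∃ M : ℝ, ∀ β ∈ D.Q, ∀ u ∈ D.Uad,
    D.f (β, D.S u, u) ≤ C → ‖u‖ ≤ M := by
  obtain ⟨u₀, hu₀⟩ := hD.Uad_nonempty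
  obtain ⟨K, hK⟩ := hD.exists_upper_bound u₀
  obtain ⟨μ, hμ, h⟩ := hD.exists_midpoint_ineq
  obtain ⟨m, hm⟩ := hD.exists_lower_bound
  -- The midpoint inequality against the fixed control `u₀`, whose value is at most `K`; the
  -- midpoint value is at least `m`.
  refine ⟨√((C + K - 2 * m) / μ) + ‖u₀‖, fun β hβ u hu hC => ?_⟩
  obtain ⟨w, hw, h⟩ := h β hβ u hu u₀ hu₀
  have h1 : ‖u - u₀‖ ^ 2 ≤ (C + K - 2 * m) / μ := by
    rw [le_div_iff₀ hμ]
    linarith [hK β hβ, hm β hβ (D.S w) w]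
  have h2 := Real.le_sqrt_of_sq_le h1
  have h3 := norm_add_le (u - u₀) u₀
  rw [sub_add_cancel] at h3
  linarith

/-- Mean value inequality on the convex set `Q`: the derivative in `β` is bounded on bounded sets,
being Lipschitz there and finite at one reference point. -/
lemma exists_lipschitz_param (M : ℝ) : ∃ C : ℝ, 0 ≤ C ∧ ∀ u ∈ D.Uad, ‖u‖ ≤ M →
    ∀ β₁ ∈ D.Q, ∀ β₂ ∈ D.Q,
      |D.f (β₁, D.S u, u) - D.f (β₂, D.S u, u)| ≤ C * ‖β₁ - β₂‖ := by
  obtain ⟨u₀, hu₀⟩ := hD.Uad_nonempty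
  obtain ⟨β₀, hβ₀⟩ := hD.Q_interior.mono interior_subset
  obtain ⟨R, hR⟩ := hD.Q_bounded.exists_norm_le
  -- A common bound for `u`, `u₀` and their states.
  set M' : ℝ := (‖D.S‖ + 1) * (|M| + ‖u₀‖) with hM'
  have hM'0 : 0 ≤ M' := by positivity
  obtain ⟨L, hL, h, -⟩ := hD.lipschitz M' hM'0
  have hball : ∀ u : U, ‖u‖ ≤ |M| + ‖u₀‖ → ‖u‖ ≤ M' ∧ ‖D.S u‖ ≤ M' := by
    intro u hu
    have h1 := D.S.le_opNorm u
    have h2 : ‖D.S‖ * ‖u‖ ≤ ‖D.S‖ * (|M| + ‖u₀‖) := by gcongr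
    have h3 : 0 ≤ ‖D.S‖ * (|M| + ‖u₀‖) := by positivity
    have h4 := norm_nonneg u
    constructor <;> rw [hM', add_mul, one_mul] <;> linarith
  have hb0 := hball u₀ (by linarith [abs_nonneg M])
  set C : ℝ := ‖D.fβ β₀ (D.S u₀) u₀‖ + L * (2 * R + 2 * M' + 2 * M')
  have hR0 : 0 ≤ R := (norm_nonneg _).trans (hR β₀ hβ₀)
  refine ⟨C, by positivity, fun u hu huM β₁ hβ₁ β₂ hβ₂ => ?_⟩
  have hb := hball u (by linarith [le_abs_self M, norm_nonneg u₀])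
  have hdiff : DifferentiableOn ℝ (fun b => D.f (b, D.S u, u)) D.Q :=
    (hD.f_contDiff.differentiableOn (by norm_num)).comp (by fun_prop)
      fun β hβ => ⟨hβ, mem_univ _⟩
  have hbound : ∀ β ∈ D.Q, ‖fderivWithin ℝ (fun b => D.f (b, D.S u, u)) D.Q β‖ ≤ C := by
    intro β hβ
    have h1 := h β hβ β₀ hβ₀ (D.S u) (D.S u₀) hb.2 hb0.2 u hu u₀ hu₀ hb.1 hb0.1
    have h2 : ‖β - β₀‖ + ‖D.S u - D.S u₀‖ + ‖u - u₀‖ ≤ 2 * R + 2 * M' + 2 * M' := by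
      linarith [norm_sub_le β β₀, norm_sub_le (D.S u) (D.S u₀), norm_sub_le u u₀,
        hR β hβ, hR β₀ hβ₀, hb.1, hb.2, hb0.1, hb0.2]
    have h3 := norm_le_norm_add_norm_sub' (D.fβ β (D.S u) u) (D.fβ β₀ (D.S u₀) u₀)
    have h4 := h1.trans (mul_le_mul_of_nonneg_left h2 hL)
    exact h3.trans (add_le_add_right h4 _)
  exact hD.convex_Q.norm_image_sub_le_of_norm_fderivWithin_le hdiff hbound hβ₂ hβ₁

/-- The optimal-value function is Lipschitz continuous. -/
lemma exists_lipschitz_φ : ∃ C : ℝ, 0 ≤ C ∧ ∀ β₁ ∈ D.Q, ∀ β₂ ∈ D.Q,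
    |D.φ β₁ - D.φ β₂| ≤ C * ‖β₁ - β₂‖ := by
  obtain ⟨K, hK⟩ := hD.exists_φ_le
  -- The tolerance below is capped at `1`, so one ball contains all the near-minimizers used and a
  -- single Lipschitz constant serves them.
  obtain ⟨M, hM⟩ := hD.exists_norm_le (K + 1)
  obtain ⟨C, hC, hlip⟩ := hD.exists_lipschitz_param M
  have key : ∀ β₁ ∈ D.Q, ∀ β₂ ∈ D.Q, D.φ β₁ - D.φ β₂ ≤ C * ‖β₁ - β₂‖ := by
    intro β₁ hβ₁ β₂ hβ₂
    refine le_of_forall_pos_le_add fun ε hε => ?_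
    obtain ⟨u, hu, hlt⟩ := hD.exists_lt_φ_add β₂ (lt_min hε one_pos)
    have h1 := hM β₂ hβ₂ u hu (by linarith [hK β₂ hβ₂, min_le_right ε 1])
    have h2 := (abs_le.1 (hlip u hu h1 β₁ hβ₁ β₂ hβ₂)).2
    linarith [hD.φ_le hβ₁ hu, min_le_left ε 1]
  refine ⟨C, hC, fun β₁ hβ₁ β₂ hβ₂ => abs_le.2 ⟨?_, key β₁ hβ₁ β₂ hβ₂⟩⟩
  have := key β₂ hβ₂ β₁ hβ₁
  rw [norm_sub_rev] at this
  linarith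

lemma tendsto_φ {β : ℕ → EuclideanSpace ℝ (Fin n)} {b : EuclideanSpace ℝ (Fin n)}
    (hβ : ∀ k, β k ∈ D.Q) (hb : b ∈ D.Q) (hlim : Tendsto β atTop (𝓝 b)) :
    Tendsto (fun k => D.φ (β k)) atTop (𝓝 (D.φ b)) := by
  obtain ⟨C, -, h⟩ := hD.exists_lipschitz_φ
  rw [tendsto_iff_norm_sub_tendsto_zero] at hlim ⊢
  refine squeeze_zero (fun _ => norm_nonneg _) (fun k => h _ (hβ k) _ hb) ?_
  simpa using hlim.const_mul C

/-- Asymptotically optimal controls for convergent parameters converge to an optimal control. -/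
lemma exists_tendsto_control [CompleteSpace U] {β : ℕ → EuclideanSpace ℝ (Fin n)}
    {b : EuclideanSpace ℝ (Fin n)} {u : ℕ → U}
    (hβ : ∀ k, β k ∈ D.Q) (hlim : Tendsto β atTop (𝓝 b)) (hu : ∀ k, u k ∈ D.Uad)
    (hopt : Tendsto (fun k => D.f (β k, D.S (u k), u k) - D.φ (β k)) atTop (𝓝 0)) :
    b ∈ D.Q ∧ ∃ v ∈ D.Uad, Tendsto u atTop (𝓝 v) ∧ D.f (b, D.S v, v) = D.φ b := by
  have hb : b ∈ D.Q := hD.isCompact_Q.isClosed.mem_of_tendsto hlim (Eventually.of_forall hβ)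
  refine ⟨hb, ?_⟩
  obtain ⟨K, hK⟩ := hD.exists_φ_le
  obtain ⟨c, hc⟩ := hopt.bddAbove_range
  obtain ⟨M, hM⟩ := hD.exists_norm_le (K + c)
  have huM : ∀ k, ‖u k‖ ≤ M := fun k => by
    have h1 : D.f (β k, D.S (u k), u k) - D.φ (β k) ≤ c := hc ⟨k, rfl⟩
    exact hM _ (hβ k) _ (hu k) (by linarith [hK _ (hβ k)])
  obtain ⟨C, -, hlip⟩ := hD.exists_lipschitz_param M
  have hφ := hD.tendsto_φ hβ hb hlim
  -- Replacing `β k` by `b` at fixed control costs a vanishing error. Hence `u` is a minimizing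
  -- sequence for the single parameter `b`, where strong convexity applies.
  have hdiff : Tendsto (fun k => D.f (b, D.S (u k), u k) - D.f (β k, D.S (u k), u k))
      atTop (𝓝 0) := by
    rw [tendsto_zero_iff_norm_tendsto_zero]
    refine squeeze_zero (fun _ => norm_nonneg _)
      (fun k => hlip _ (hu k) (huM k) _ hb _ (hβ k)) ?_
    have := (tendsto_iff_norm_sub_tendsto_zero.1 hlim).const_mul C
    simpa [norm_sub_rev] using this
  have hval : Tendsto (fun k => D.f (b, D.S (u k), u k) - D.φ b) atTop (𝓝 0) := by
    have := (hdiff.add hopt).add (hφ.sub_const (D.φ b))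
    simp only [add_zero, sub_self] at this
    exact this.congr fun k => by ring
  obtain ⟨μ, hμ, hsq⟩ := hD.exists_norm_sub_sq_le
  have hcauchy : CauchySeq u := by
    rw [Metric.cauchySeq_iff]
    intro ε hε
    obtain ⟨N, hN⟩ := eventually_atTop.1
      (hval.eventually (gt_mem_nhds (show 0 < μ * ε ^ 2 / 2 by positivity)))
    refine ⟨N, fun i hi j hj => ?_⟩
    have h1 := hsq b hb _ (hu i) _ (hu j)
    have h2 : μ * ‖u i - u j‖ ^ 2 < μ * ε ^ 2 := by linarith [hN i hi, hN j hj]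
    rw [dist_eq_norm]
    exact lt_of_pow_lt_pow_left₀ 2 hε.le (lt_of_mul_lt_mul_left h2 hμ.le)
  obtain ⟨v, hv⟩ := cauchySeq_tendsto_of_complete hcauchy
  refine ⟨v, hD.Uad_closed.mem_of_tendsto hv (Eventually.of_forall hu), hv, ?_⟩
  have hcont : ContinuousOn (fun w => D.f (b, D.S w, w)) univ :=
    hD.f_contDiff.continuousOn.comp (by fun_prop) fun w _ => ⟨hb, mem_univ _⟩
  have h1 := ((continuousOn_univ.1 hcont).tendsto v).comp hv
  have h2 : Tendsto (fun k => D.f (b, D.S (u k), u k)) atTop (𝓝 (D.φ b)) := by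
    simpa using hval.add_const (D.φ b)
  exact tendsto_nhds_unique h1 h2

/-- The case of a constant parameter in `exists_tendsto_control`, applied to a minimizing sequence.
-/
lemma exists_minimizer [CompleteSpace U] {b : EuclideanSpace ℝ (Fin n)} (hb : b ∈ D.Q) :
    ∃ v ∈ D.Uad, D.f (b, D.S v, v) = D.φ b := by
  choose u hu hlt using fun k : ℕ =>
    hD.exists_lt_φ_add b (ε := 1 / ((k : ℝ) + 1)) (by positivity)
  obtain ⟨-, v, hv, -, h⟩ := hD.exists_tendsto_control (fun _ => hb) tendsto_const_nhds hu
    (squeeze_zero (fun k => sub_nonneg.2 (hD.φ_le hb (hu k)))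
      (fun k => by linarith [hlt k]) tendsto_one_div_add_atTop_nhds_zero_nat)
  exact ⟨v, hv, h⟩

end StandingAssumption

end Lower

end BilevelData

/-! ### Geometry of simplices: interpolation error, and volume against diameter. -/

namespace FullSimplex

variable {n : ℕ} (T : FullSimplex n)

lemma carrier_eq : T.carrier = {x | ∀ i, 0 ≤ T.affineBasis.coord i x} :=
  T.affineBasis.convexHull_eq_nonneg_coord

lemma points_mem_carrier (i : Fin (n + 1)) : T.points i ∈ T.carrier :=
  subset_convexHull ℝ _ (mem_range_self i)

lemma sum_coord_smul (x : EuclideanSpace ℝ (Fin n)) :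
    ∑ i, T.affineBasis.coord i x • T.points i = x :=
  T.affineBasis.linear_combination_coord_eq_self x

lemma isCompact_carrier : IsCompact T.carrier :=
  (finite_range _).isCompact_convexHull (𝕜 := ℝ)

lemma vol_pos : 0 < T.vol := by
  have hne : (interior T.carrier).Nonempty :=
    interior_convexHull_nonempty_iff_affineSpan_eq_top.2 T.affineBasis.tot
  exact ENNReal.toReal_pos (Measure.measure_pos_of_nonempty_interior _ hne).ne'
    T.isCompact_carrier.measure_lt_top.ne

/-- The interpolation error of a Lipschitz function. -/
lemma abs_interpolant_sub_le {g : EuclideanSpace ℝ (Fin n) → ℝ} {C : ℝ} (hC : 0 ≤ C)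
    (hg : ∀ x ∈ T.carrier, ∀ y ∈ T.carrier, |g x - g y| ≤ C * ‖x - y‖)
    {x : EuclideanSpace ℝ (Fin n)} (hx : x ∈ T.carrier) :
    |T.interpolant g x - g x| ≤ C * Metric.diam T.carrier := by
  have hsum := T.affineBasis.sum_coord_apply_eq_one x
  have hnn : ∀ i, 0 ≤ T.affineBasis.coord i x := by
    rw [carrier_eq] at hx; exact hx
  have e : T.interpolant g x - g x
      = ∑ i, T.affineBasis.coord i x * (g (T.points i) - g x) := by
    simp only [interpolant, mul_sub, Finset.sum_sub_distrib]
    rw [← Finset.sum_mul, hsum, one_mul]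
  rw [e]
  calc |∑ i, T.affineBasis.coord i x * (g (T.points i) - g x)|
      ≤ ∑ i, |T.affineBasis.coord i x * (g (T.points i) - g x)| :=
        Finset.abs_sum_le_sum_abs _ _
    _ ≤ ∑ i, T.affineBasis.coord i x * (C * Metric.diam T.carrier) := by
        refine Finset.sum_le_sum fun i _ => ?_
        rw [abs_mul, abs_of_nonneg (hnn i)]
        refine mul_le_mul_of_nonneg_left ((hg _ (T.points_mem_carrier i) _ hx).trans ?_) (hnn i)
        rw [← dist_eq_norm]
        exact mul_le_mul_of_nonneg_left (Metric.dist_le_diam_of_mem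
          T.isCompact_carrier.isBounded (T.points_mem_carrier i) hx) hC
    _ = C * Metric.diam T.carrier := by rw [← Finset.sum_mul, hsum, one_mul]

/-- A shape-regular simplex of diameter at least `ε` contains a ball of proportional radius. -/
lemma le_vol_of_le_diam {ρ ε : ℝ} (hρ : 0 < ρ) (hε : 0 < ε) (hT : ρ ≤ T.aspectRatio)
    (hdiam : ε ≤ Metric.diam T.carrier) :
    volume.real (Metric.closedBall (0 : EuclideanSpace ℝ (Fin n)) (ρ * ε / 4)) ≤ T.vol := by
  have hd : 0 < Metric.diam T.carrier := hε.trans_le hdiam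
  have h1 := (le_div_iff₀ hd).1 hT
  -- Halving makes the inequality strict, so some ball in `T` has diameter above `ρ * ε / 2`, hence
  -- radius at least `ρ * ε / 4`. Nonemptiness is witnessed by the empty ball of radius `-1`.
  have h2 : ρ * ε / 2 < sSup {d | ∃ (c : EuclideanSpace ℝ (Fin n)) (r : ℝ),
      Metric.closedBall c r ⊆ T.carrier ∧ d = Metric.diam (Metric.closedBall c r)} := by
    have : ρ * ε ≤ ρ * Metric.diam T.carrier := by gcongr
    have : 0 < ρ * ε := by positivity
    linarith
  obtain ⟨_, ⟨c, r, hsub, rfl⟩, hlt⟩ := exists_lt_of_lt_csSup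
    (by exact ⟨_, 0, -1, by simp, rfl⟩) h2
  have hr0 : 0 ≤ r := by
    by_contra hr
    rw [Metric.closedBall_eq_empty.2 (not_le.1 hr), Metric.diam_empty] at hlt
    have : 0 < ρ * ε := by positivity
    linarith
  have hr : ρ * ε / 4 ≤ r := by
    linarith [Metric.diam_closedBall (x := c) hr0]
  calc volume.real (Metric.closedBall (0 : EuclideanSpace ℝ (Fin n)) (ρ * ε / 4))
      = volume.real (Metric.closedBall c (ρ * ε / 4)) := by
        simp only [Measure.real, Measure.addHaar_closedBall_center volume c]
    _ ≤ T.vol := measureReal_mono ((Metric.closedBall_subset_closedBall hr).trans hsub)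
        T.isCompact_carrier.measure_lt_top.ne

end FullSimplex

/-! ### Runs of the algorithm: lower bounds for (OVR). -/

namespace BilevelData

section Run

variable {n : ℕ} {Y U : Type*}
  [NormedAddCommGroup Y] [InnerProductSpace ℝ Y]
  [NormedAddCommGroup U] [InnerProductSpace ℝ U]
  {D : BilevelData n Y U}

/-- The optimal-value function is convex, so its interpolants lie above it. -/
lemma StandingAssumption.φ_le_ξ [CompleteSpace U] (hD : D.StandingAssumption)
    {T : FullSimplex n} (hT : T.carrier ⊆ D.Q) {β : EuclideanSpace ℝ (Fin n)}
    (hβ : β ∈ T.carrier) : D.φ β ≤ D.ξ T β := by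
  choose v hv hmin using fun i => hD.exists_minimizer (hT (T.points_mem_carrier i))
  have hsum := T.affineBasis.sum_coord_apply_eq_one β
  have hnn : ∀ i, 0 ≤ T.affineBasis.coord i β := by
    rw [T.carrier_eq] at hβ; exact hβ
  -- Jensen's inequality for the lower-level minimizers at the vertices, weighted by the barycentric
  -- coordinates of `β`; the averaged control is admissible at `β`.
  have hJ := hD.f_convex.map_sum_le (t := Finset.univ)
    (w := fun i => T.affineBasis.coord i β)
    (p := fun i => (T.points i, D.S (v i), v i)) (fun i _ => hnn i) hsum
    (fun i _ => ⟨hT (T.points_mem_carrier i), mem_univ _⟩)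
  have hw : ∑ i, T.affineBasis.coord i β • v i ∈ D.Uad :=
    hD.Uad_convex.sum_mem (fun i _ => hnn i) hsum fun i _ => hv i
  have e : ∑ i, T.affineBasis.coord i β • ((T.points i, D.S (v i), v i) :
        EuclideanSpace ℝ (Fin n) × Y × U)
      = (β, D.S (∑ i, T.affineBasis.coord i β • v i), ∑ i, T.affineBasis.coord i β • v i) := by
    refine Prod.ext ?_ (Prod.ext ?_ ?_)
    · simp [Prod.fst_sum, T.sum_coord_smul]
    · simp [Prod.fst_sum, Prod.snd_sum, map_sum]
    · simp [Prod.snd_sum]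
  rw [e] at hJ
  refine (hD.φ_le (hT hβ) hw).trans (hJ.trans (le_of_eq ?_))
  simp [ξ, FullSimplex.interpolant, hmin]

variable {P : ℝ → ℝ} {q ρ : ℝ} {I : PenaltyIterates n Y U} {N : ℕ∞}

namespace IsPenaltyRun

lemma isSubdivision (hrun : D.IsPenaltyRun P q ρ I N) :
    ∀ k : ℕ, (k : ℕ∞) < N → IsSubdivision (I.𝒯 k) D.Q := by
  intro k
  induction k with
  | zero => exact fun _ => hrun.initial
  | succ k ih =>
    intro hk
    have hk' : (k : ℕ∞) + 1 < N := by exact_mod_cast hk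
    have hk0 : (k : ℕ∞) < N := lt_of_le_of_lt le_self_add hk'
    obtain ⟨hfin, hun⟩ := ih hk0
    obtain ⟨R, ⟨hRfin, hR⟩, -, he⟩ := hrun.refine_step k hk'
    refine ⟨he ▸ (hfin.sdiff).union hRfin, ?_⟩
    rw [he, biUnion_union, hR, ← hun]
    have hmem := hrun.Tbar_mem k hk0
    conv_rhs => rw [← sdiff_union_of_subset (singleton_subset_iff.2 hmem), biUnion_union]
    simp

lemma carrier_subset (hrun : D.IsPenaltyRun P q ρ I N) {k : ℕ} (hk : (k : ℕ∞) < N)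
    {T : FullSimplex n} (hT : T ∈ I.𝒯 k) : T.carrier ⊆ D.Q := by
  rw [← (hrun.isSubdivision k hk).2]
  exact subset_biUnion_of_mem (u := fun T => FullSimplex.carrier T) hT

lemma x_feasible (hrun : D.IsPenaltyRun P q ρ I N) {k : ℕ} (hk : (k : ℕ∞) < N) :
    I.x k ∈ D.penaltyFeasible (I.Tbar k) :=
  (hrun.solves k hk _ (hrun.Tbar_mem k hk)).1

lemma x_mem_Q (hrun : D.IsPenaltyRun P q ρ I N) {k : ℕ} (hk : (k : ℕ∞) < N) :
    (I.x k).1 ∈ D.Q :=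
  hrun.carrier_subset hk (hrun.Tbar_mem k hk) (hrun.x_feasible hk).1

lemma x_eq (hrun : D.IsPenaltyRun P q ρ I N) {k : ℕ} (hk : (k : ℕ∞) < N) :
    I.x k = ((I.x k).1, D.S (I.x k).2.2, (I.x k).2.2) :=
  Prod.ext rfl (Prod.ext ((D.state_eq_iff _ _).1 (hrun.x_feasible hk).2.1) rfl)

/-- The penalty problems are relaxations of (OVR). -/
lemma penaltyObjective_le [CompleteSpace U] (hD : D.StandingAssumption)
    (hPzero : ∀ s : ℝ, s ≤ 0 → P s = 0)
    (hrun : D.IsPenaltyRun P q ρ I N) {k : ℕ} (hk : (k : ℕ∞) < N)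
    {z : EuclideanSpace ℝ (Fin n) × Y × U} (hz : z ∈ D.ovrFeasible) :
    D.penaltyObjective P (I.Tbar k) (I.γ k (I.Tbar k)) (I.x k) ≤ D.F z := by
  obtain ⟨hzQ, hzφ, hzA, hzU⟩ := hz
  have hzQ' := hzQ
  rw [← (hrun.isSubdivision k hk).2, mem_iUnion₂] at hzQ'
  obtain ⟨T, hT, hzT⟩ := hzQ'
  refine (hrun.Tbar_argmin k hk T hT).trans
    (((hrun.solves k hk T hT).2 z ⟨hzT, hzA, hzU⟩).trans (le_of_eq ?_))
  -- Feasibility gives `f z ≤ φ ≤ ξ`, so the argument of `P` is nonpositive.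
  have := hD.φ_le_ξ (hrun.carrier_subset hk hT) hzT
  rw [penaltyObjective, hPzero _ (by linarith), mul_zero, add_zero]

lemma F_le [CompleteSpace U] (hD : D.StandingAssumption)
    (hPmono : Monotone P) (hPzero : ∀ s : ℝ, s ≤ 0 → P s = 0)
    (hrun : D.IsPenaltyRun P q ρ I N) {k : ℕ} (hk : (k : ℕ∞) < N)
    {z : EuclideanSpace ℝ (Fin n) × Y × U} (hz : z ∈ D.ovrFeasible) : D.F (I.x k) ≤ D.F z := by
  have hP0 : ∀ s, 0 ≤ P s := fun s => by
    rw [← hPzero (min s 0) (min_le_right _ _)]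
    exact hPmono (min_le_left _ _)
  have h1 := hrun.penaltyObjective_le hD hPzero hk hz
  have h2 := mul_nonneg (hrun.γ_pos k hk _ (hrun.Tbar_mem k hk)).le
    (hP0 (D.f (I.x k) - D.ξ (I.Tbar k) (I.x k).1))
  rw [penaltyObjective] at h1
  linarith

lemma isOVRSolution_of_terminal [CompleteSpace U] (hD : D.StandingAssumption)
    (hPmono : Monotone P) (hPzero : ∀ s : ℝ, s ≤ 0 → P s = 0)
    {K : ℕ} (hrun : D.IsPenaltyRun P q ρ I (K + 1)) : D.IsOVRSolution (I.x K) := by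
  have hk : (K : ℕ∞) < K + 1 := by exact_mod_cast K.lt_succ_self
  exact ⟨⟨hrun.x_mem_Q hk, (hrun.terminal K rfl).le, (hrun.x_feasible hk).2⟩,
    fun z hz => hrun.F_le hD hPmono hPzero hk hz⟩

/-! ### Shrinking of the selected simplices. -/

lemma mem_succ (hrun : D.IsPenaltyRun P q ρ I ⊤) {k : ℕ} {T : FullSimplex n}
    (hT : T ∈ I.𝒯 (k + 1)) :
    (T ∈ I.𝒯 k ∧ T ≠ I.Tbar k) ∨ T ∈ I.𝒯 (k + 1) \ I.𝒯 k := by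
  by_cases h : T ∈ I.𝒯 k
  · refine Or.inl ⟨h, ?_⟩
    rintro rfl
    obtain ⟨R, -, hnot, he⟩ := hrun.refine_step k (by exact_mod_cast ENat.natCast_lt_top (k + 1))
    rw [he] at hT
    exact hT.elim (fun h => h.2 rfl) hnot
  · exact Or.inr ⟨hT, h⟩

/-- The volume of the selected simplices eventually drops below every threshold `V q ^ m`. -/
lemma exists_vol_le (hrun : D.IsPenaltyRun P q ρ I ⊤) {V : ℝ}
    (hV : ∀ k, ∀ T ∈ I.𝒯 k, FullSimplex.vol T ≤ V) (hq : 0 ≤ q) (m : ℕ) :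
    ∃ K, ∀ k, K ≤ k → FullSimplex.vol (I.Tbar k) ≤ V * q ^ m := by
  have hlt : ∀ k : ℕ, (k : ℕ∞) < ⊤ := ENat.natCast_lt_top
  have hlt' : ∀ k : ℕ, (k : ℕ∞) + 1 < ⊤ := fun k => by exact_mod_cast ENat.natCast_lt_top (k + 1)
  induction m with
  | zero => exact ⟨0, fun k _ => by simpa using hV k _ (hrun.Tbar_mem k (hlt k))⟩
  | succ m ih =>
    obtain ⟨K, hK⟩ := ih
    -- The simplices still above the next threshold. From iteration `K` on, new simplices have
    -- volume at most `q * (V * q ^ m)`, so none enters `G`, and selecting a member removes it. The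
    -- finite cardinality can drop only finitely often, so members are eventually never selected.
    set G : ℕ → Set (FullSimplex n) := fun k =>
      {T ∈ I.𝒯 (K + k) | V * q ^ (m + 1) < FullSimplex.vol T} with hG
    have hfin : ∀ k, (G k).Finite := fun k =>
      ((hrun.isSubdivision _ (hlt _)).1).subset (sep_subset _ _)
    have hstep : ∀ k, ∀ T ∈ G (k + 1), T ∈ G k ∧ T ≠ I.Tbar (K + k) := by
      rintro k T ⟨hT, hvol⟩
      rcases hrun.mem_succ (k := K + k) hT with h | h
      · exact ⟨⟨h.1, hvol⟩, h.2⟩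
      · exfalso
        have h1 := hrun.refine_vol (K + k) (hlt' _) T h
        have h2 := mul_le_mul_of_nonneg_left (hK (K + k) (by omega)) hq
        have h3 : q * (V * q ^ m) = V * q ^ (m + 1) := by ring
        linarith
    have hanti : Antitone fun k => (G k).ncard :=
      antitone_nat_of_succ_le fun k =>
        ncard_le_ncard (fun T hT => (hstep k T hT).1) (hfin k)
    obtain ⟨J, hJ⟩ := WellFoundedGT.monotone_chain_condition
      (⟨fun k => OrderDual.toDual (G k).ncard, hanti⟩ : ℕ →o ℕᵒᵈ)
    refine ⟨K + J, fun k hk => ?_⟩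
    by_contra hvol
    obtain ⟨j, rfl⟩ := Nat.exists_eq_add_of_le (show K ≤ k by omega)
    have hmem : I.Tbar (K + j) ∈ G j := ⟨hrun.Tbar_mem _ (hlt _), not_le.1 hvol⟩
    have h1 : (G (j + 1)).ncard < (G j).ncard :=
      ncard_lt_ncard ((ssubset_iff_of_subset fun T hT => (hstep j T hT).1).2
        ⟨_, hmem, fun h => (hstep j _ h).2 rfl⟩) (hfin j)
    have h2 : (G J).ncard = (G j).ncard := hJ j (by omega)
    have h3 : (G J).ncard = (G (j + 1)).ncard := hJ (j + 1) (by omega)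
    omega

lemma tendsto_vol (hrun : D.IsPenaltyRun P q ρ I ⊤) (hq : q ∈ Ioo (0 : ℝ) 1) :
    Tendsto (fun k => FullSimplex.vol (I.Tbar k)) atTop (𝓝 0) := by
  obtain ⟨V, hV⟩ := (hrun.initial.1.image FullSimplex.vol).bddAbove
  have hV' : ∀ k, ∀ T ∈ I.𝒯 k, FullSimplex.vol T ≤ V := by
    intro k
    induction k with
    | zero => exact fun T hT => hV ⟨T, hT, rfl⟩
    | succ k ih =>
      intro T hT
      rcases hrun.mem_succ hT with h | h
      · exact ih T h.1
      · have h1 := hrun.refine_vol k (by exact_mod_cast ENat.natCast_lt_top (k + 1)) T h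
        have h2 := ih _ (hrun.Tbar_mem k (ENat.natCast_lt_top k))
        have h3 := FullSimplex.vol_pos (I.Tbar k)
        nlinarith [hq.1, hq.2]
  have hlim : Tendsto (fun m : ℕ => V * q ^ m) atTop (𝓝 0) := by
    simpa using (tendsto_pow_atTop_nhds_zero_of_lt_one hq.1.le hq.2).const_mul V
  rw [Metric.tendsto_atTop]
  intro ε hε
  obtain ⟨m, hm⟩ := (hlim.eventually (gt_mem_nhds hε)).exists
  obtain ⟨K, hK⟩ := hrun.exists_vol_le hV' hq.1.le m
  refine ⟨K, fun k hk => ?_⟩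
  rw [Real.dist_eq, sub_zero, abs_of_pos (FullSimplex.vol_pos _)]
  exact (hK k hk).trans_lt hm

lemma initial_or_aspect (hrun : D.IsPenaltyRun P q ρ I ⊤) (k : ℕ) :
    ∀ T ∈ I.𝒯 k, T ∈ I.𝒯 0 ∨ ρ ≤ FullSimplex.aspectRatio T := by
  induction k with
  | zero => exact fun T hT => Or.inl hT
  | succ k ih =>
    intro T hT
    rcases hrun.mem_succ hT with h | h
    · exact ih T h.1
    · exact Or.inr (hrun.refine_aspect k (by exact_mod_cast ENat.natCast_lt_top (k + 1)) T h)

/-- A selected simplex of large diameter and controlled aspect ratio would have volume bounded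
below. The initial simplices have no prescribed aspect ratio, but they are finitely many with
positive volumes, so eventually none of them is selected. -/
lemma tendsto_diam (hrun : D.IsPenaltyRun P q ρ I ⊤) (hq : q ∈ Ioo (0 : ℝ) 1) (hρ : 0 < ρ) :
    Tendsto (fun k => Metric.diam (FullSimplex.carrier (I.Tbar k))) atTop (𝓝 0) := by
  have hvol := hrun.tendsto_vol hq
  rw [Metric.tendsto_atTop]
  intro ε hε
  have hball : 0 < volume.real
      (Metric.closedBall (0 : EuclideanSpace ℝ (Fin n)) (ρ * ε / 4)) :=
    ENNReal.toReal_pos (Metric.measure_closedBall_pos volume _ (by positivity)).ne'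
      measure_closedBall_lt_top.ne
  have hinit : ∀ᶠ k in atTop, ∀ T ∈ I.𝒯 0, FullSimplex.vol (I.Tbar k) < FullSimplex.vol T :=
    (eventually_all_finite hrun.initial.1).2 fun T _ =>
      hvol.eventually (gt_mem_nhds (FullSimplex.vol_pos T))
  obtain ⟨K, hK⟩ := eventually_atTop.1 (hinit.and (hvol.eventually (gt_mem_nhds hball)))
  refine ⟨K, fun k hk => ?_⟩
  obtain ⟨h1, h2⟩ := hK k hk
  rw [Real.dist_eq, sub_zero, abs_of_nonneg Metric.diam_nonneg]
  by_contra hdiam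
  rcases hrun.initial_or_aspect k _ (hrun.Tbar_mem k (ENat.natCast_lt_top k)) with h | h
  · exact (h1 _ h).false
  · exact absurd (FullSimplex.le_vol_of_le_diam _ hρ hε h (not_lt.1 hdiam)) (not_le.2 h2)

/-! ### Asymptotic feasibility and convergence of the iterates. -/

/-- The iterates are asymptotically feasible for (OVR). -/
lemma tendsto_f_sub_φ [CompleteSpace U] (hD : D.StandingAssumption)
    (hPmono : Monotone P) (hPzero : ∀ s : ℝ, s ≤ 0 → P s = 0) (hPpos : ∀ s : ℝ, 0 < s → 0 < P s)
    (hq : q ∈ Ioo (0 : ℝ) 1) (hρ : 0 < ρ) (hrun : D.IsPenaltyRun P q ρ I ⊤)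
    (hγ : Tendsto (fun k => I.γ k (I.Tbar k)) atTop atTop) :
    Tendsto (fun k => D.f (I.x k) - D.φ (I.x k).1) atTop (𝓝 0) := by
  have hlt : ∀ k : ℕ, (k : ℕ∞) < ⊤ := ENat.natCast_lt_top
  obtain ⟨β₀, hβ₀⟩ := hD.Q_interior.mono interior_subset
  obtain ⟨v₀, hv₀, hmin⟩ := hD.exists_minimizer hβ₀
  have hz : (β₀, D.S v₀, v₀) ∈ D.ovrFeasible :=
    ⟨hβ₀, hmin.le, (D.state_eq_iff _ _).2 rfl, hv₀⟩
  obtain ⟨m, hm⟩ := hD.F_bddBelow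
  -- One feasible reference point and the lower bound of `F` bound all penalty terms uniformly.
  have hpen : ∀ k, I.γ k (I.Tbar k) * P (D.f (I.x k) - D.ξ (I.Tbar k) (I.x k).1)
      ≤ D.F (β₀, D.S v₀, v₀) - m := fun k => by
    have h1 := hrun.penaltyObjective_le hD hPzero (hlt k) hz
    have h2 : m ≤ D.F (I.x k) := hm ⟨_, ⟨hrun.x_mem_Q (hlt k), mem_univ _⟩, rfl⟩
    rw [penaltyObjective] at h1
    linarith
  obtain ⟨C, hC, hlip⟩ := hD.exists_lipschitz_φ
  have herr : ∀ k, |D.ξ (I.Tbar k) (I.x k).1 - D.φ (I.x k).1|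
      ≤ C * Metric.diam (FullSimplex.carrier (I.Tbar k)) := fun k => by
    have hsub := hrun.carrier_subset (hlt k) (hrun.Tbar_mem k (hlt k))
    exact FullSimplex.abs_interpolant_sub_le _ hC
      (fun x hx y hy => hlip x (hsub hx) y (hsub hy)) (hrun.x_feasible (hlt k)).1
  have hdiam : Tendsto (fun k => C * Metric.diam (FullSimplex.carrier (I.Tbar k)))
      atTop (𝓝 0) := by
    simpa using (hrun.tendsto_diam hq hρ).const_mul C
  rw [Metric.tendsto_atTop]
  intro ε hε
  have hPε := hPpos (ε / 2) (by positivity)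
  obtain ⟨K, hK⟩ := eventually_atTop.1 ((hdiam.eventually (gt_mem_nhds (half_pos hε))).and
    (hγ.eventually_gt_atTop ((D.F (β₀, D.S v₀, v₀) - m) / P (ε / 2))))
  refine ⟨K, fun k hk => ?_⟩
  obtain ⟨h1, h2⟩ := hK k hk
  have hge : D.φ (I.x k).1 ≤ D.f (I.x k) := by
    rw [hrun.x_eq (hlt k)]
    exact hD.φ_le (hrun.x_mem_Q (hlt k)) (hrun.x_feasible (hlt k)).2.2
  rw [Real.dist_eq, sub_zero, abs_of_nonneg (sub_nonneg.2 hge)]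
  -- Otherwise monotonicity of `P` makes the penalty term at least `γ * P (ε / 2)`, which exceeds
  -- the uniform bound.
  have h3 : D.f (I.x k) - D.ξ (I.Tbar k) (I.x k).1 < ε / 2 := by
    by_contra h
    rw [div_lt_iff₀ hPε] at h2
    have h4 := mul_le_mul_of_nonneg_left (hPmono (not_lt.1 h))
      (hrun.γ_pos k (hlt k) _ (hrun.Tbar_mem k (hlt k))).le
    linarith [hpen k]
  linarith [(abs_le.1 (herr k)).2]

/-- Every subsequence of the iterates has a further subsequence converging to a solution. -/
lemma exists_subseq_tendsto [CompleteSpace U] (hD : D.StandingAssumption)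
    (hPmono : Monotone P) (hPzero : ∀ s : ℝ, s ≤ 0 → P s = 0) (hPpos : ∀ s : ℝ, 0 < s → 0 < P s)
    (hq : q ∈ Ioo (0 : ℝ) 1) (hρ : 0 < ρ) (hrun : D.IsPenaltyRun P q ρ I ⊤)
    (hγ : Tendsto (fun k => I.γ k (I.Tbar k)) atTop atTop)
    {r : ℕ → ℕ} (hr : Tendsto r atTop atTop) :
    ∃ (x : EuclideanSpace ℝ (Fin n) × Y × U) (s : ℕ → ℕ), D.IsOVRSolution x ∧ StrictMono s ∧
      Tendsto (fun j => I.x (r (s j))) atTop (𝓝 x) := by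
  have hlt : ∀ k : ℕ, (k : ℕ∞) < ⊤ := ENat.natCast_lt_top
  obtain ⟨b, -, s, hs, hb⟩ := hD.isCompact_Q.tendsto_subseq
    (x := fun k => (I.x (r k)).1) fun k => hrun.x_mem_Q (hlt _)
  have hrs : Tendsto (fun j => r (s j)) atTop atTop := hr.comp hs.tendsto_atTop
  have hopt : Tendsto (fun j => D.f ((I.x (r (s j))).1, D.S (I.x (r (s j))).2.2,
      (I.x (r (s j))).2.2) - D.φ (I.x (r (s j))).1) atTop (𝓝 0) := by
    simp only [← hrun.x_eq (hlt _)]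
    exact (hrun.tendsto_f_sub_φ hD hPmono hPzero hPpos hq hρ hγ).comp hrs
  obtain ⟨hbQ, v, hv, hlim, hval⟩ := hD.exists_tendsto_control
    (fun j => hrun.x_mem_Q (hlt (r (s j)))) hb
    (fun j => (hrun.x_feasible (hlt (r (s j)))).2.2) hopt
  have hx : Tendsto (fun j => I.x (r (s j))) atTop (𝓝 (b, D.S v, v)) := by
    refine (hb.prodMk_nhds (((D.S.continuous.tendsto v).comp hlim).prodMk_nhds hlim)).congr ?_
    exact fun j => (hrun.x_eq (hlt _)).symm
  refine ⟨(b, D.S v, v), s, ⟨⟨hbQ, hval.le, (D.state_eq_iff _ _).2 rfl, hv⟩, fun z hz => ?_⟩,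
    hs, hx⟩
  have hF : Tendsto (fun j => D.F (I.x (r (s j)))) atTop (𝓝 (D.F (b, D.S v, v))) :=
    (hD.F_contDiff.continuousOn (b, D.S v, v) ⟨hbQ, mem_univ _⟩).tendsto.comp
      (tendsto_nhdsWithin_iff.2 ⟨hx, Eventually.of_forall fun j =>
        ⟨hrun.x_mem_Q (hlt _), mem_univ _⟩⟩)
  exact le_of_tendsto' hF fun j => hrun.F_le hD hPmono hPzero (hlt _) hz

end IsPenaltyRun

end Run

end BilevelData

theorem mainTheorem2 {n : ℕ} {Y U : Type*}
    [NormedAddCommGroup Y] [InnerProductSpace ℝ Y] [CompleteSpace Y]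
    [NormedAddCommGroup U] [InnerProductSpace ℝ U] [CompleteSpace U]
    (D : BilevelData n Y U) (hD : D.StandingAssumption)
    (P : ℝ → ℝ) (hPmono : Monotone P) (hPconv : ConvexOn ℝ Set.univ P)
    (hPzero : ∀ s : ℝ, s ≤ 0 → P s = 0) (hPpos : ∀ s : ℝ, 0 < s → 0 < P s)
    (q ρ : ℝ) (hq : q ∈ Set.Ioo (0 : ℝ) 1) (hρ : ρ ∈ Set.Ioo (0 : ℝ) 1)
    (I : BilevelData.PenaltyIterates n Y U) (N : ℕ∞) (hrun : D.IsPenaltyRun P q ρ I N)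
    (hγ : N = ⊤ → Filter.Tendsto (fun k => I.γ k (I.Tbar k)) Filter.atTop Filter.atTop) :
    ((∃ K : ℕ, N = (K : ℕ∞) + 1 ∧ D.IsOVRSolution (I.x K)) ∨
      (N = ⊤ ∧ ∃ (xhat : EuclideanSpace ℝ (Fin n) × Y × U) (s : ℕ → ℕ),
        D.IsOVRSolution xhat ∧ StrictMono s ∧
          Filter.Tendsto (fun j => I.x (s j)) Filter.atTop (nhds xhat))) ∧
    (N = ⊤ → ∀ xbar : EuclideanSpace ℝ (Fin n) × Y × U,
      D.IsOVRSolution xbar → (∀ z, D.IsOVRSolution z → z = xbar) →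
        Filter.Tendsto I.x Filter.atTop (nhds xbar)) := by
  refine ⟨?_, ?_⟩
  · rcases eq_or_ne N ⊤ with rfl | hN
    · right
      obtain ⟨x, s, hx, hs, hlim⟩ := hrun.exists_subseq_tendsto hD hPmono hPzero hPpos hq hρ.1
        (hγ rfl) tendsto_id
      exact ⟨rfl, x, s, hx, hs, hlim⟩
    · left
      lift N to ℕ using hN
      obtain ⟨K, rfl⟩ : ∃ K, N = K + 1 :=
        Nat.exists_eq_succ_of_ne_zero (by rintro rfl; exact absurd hrun.N_pos (by simp))
      exact ⟨K, by push_cast; rfl,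
        BilevelData.IsPenaltyRun.isOVRSolution_of_terminal hD hPmono hPzero
          (by exact_mod_cast hrun)⟩
  · rintro rfl xbar - huniq
    refine tendsto_of_subseq_tendsto fun r hr => ?_
    obtain ⟨x, s, hx, -, hlim⟩ := hrun.exists_subseq_tendsto hD hPmono hPzero hPpos hq hρ.1
      (hγ rfl) hr
    exact ⟨s, huniq x hx ▸ hlim⟩
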